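/- Let $d\ge 1$ and let $f:\mathbb{R}^d\to\mathbb{R}$ be differentiable with an $L$-Lipschitz gradient, $\|\nabla f(y)-\nabla f(x)\|\le L\|y-x\|$ for all $x,y$, and $\mu$-strongly convex, $f(y)\ge f(x)+\langle\nabla f(x),y-x\rangle+\frac{\mu}{2}\|y-x\|^2$ for all $x,y$, where $L,\mu>0$ and $\|\cdot\|$ is the Euclidean norm. Let $x^*$ be the unique minimizer of $f$. Fix $x_0\in\mathbb{R}^d$, a smoothing radius $\alpha>0$, an integer $T\ge1$ and $0<\delta<1$. Let $u_0,u_1,\dots$ be independent $\mathcal N(0,I_d)$ random vectors and define, for $t=0,\dots,T-1$, $$x_{t+1}=x_t-\eta_t\,\frac{f(x_t+\alpha u_t)-f(x_t-\alpha u_t)}{2\alpha}\,u_t,\qquad \eta_t=\frac{1}{4L\|u_t\|^2},$$ which is well defined almost surely. Then, with probability at least $1-\delta$, $$f(x_T)-f(x^*)\le\exp\left(-\frac{\mu}{8L}\left(\frac{T}{2d}-\frac{6\log(3/\delta)}{d}\right)\right)\bigl(f(x_0)-f(x^*)\bigr)+\frac{dL\alpha^2}{16}\left(1004+1000\left(\log\frac3\delta+\log\log(2T)\right)+\frac{32dL}{\mu}+3\log\frac3\delta\right).$$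 -/

import Mathlib

open MeasureTheory ProbabilityTheory

noncomputable section

namespace ZerothOrder

/-- `f : ℝᵈ → ℝ` is differentiable and has an `L`-Lipschitz gradient (Euclidean norm). -/
def HasLipschitzGradient {d : ℕ} (f : EuclideanSpace ℝ (Fin d) → ℝ) (L : ℝ) : Prop :=
  Differentiable ℝ f ∧ ∀ x y, ‖gradient f y - gradient f x‖ ≤ L * ‖y - x‖

/-- First-order `μ`-strong convexity of a differentiable function:
`f y ≥ f x + ⟨∇ f x, y - x⟩ + (μ / 2) ‖y - x‖²` for all `x, y`. -/
def IsStronglyConvex {d : ℕ} (f : EuclideanSpace ℝ (Fin d) → ℝ) (μ : ℝ) : Prop :=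
  ∀ x y, f x + inner ℝ (gradient f x) (y - x) + μ / 2 * ‖y - x‖ ^ 2 ≤ f y

/-- The two-point estimator `((f (x + α u) - f (x - α u)) / (2 α)) u`. -/
def gradEstimate {d : ℕ} (f : EuclideanSpace ℝ (Fin d) → ℝ) (α : ℝ)
    (x u : EuclideanSpace ℝ (Fin d)) : EuclideanSpace ℝ (Fin d) :=
  ((f (x + α • u) - f (x - α • u)) / (2 * α)) • u

/-- The normalized step size `1 / (4 L ‖u‖²)`; the value at `u = 0` (a null event for a Gaussian
direction in dimension at least one) is irrelevant. -/
def stepSize {d : ℕ} (L : ℝ) (u : EuclideanSpace ℝ (Fin d)) : ℝ :=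
  1 / (4 * L * ‖u‖ ^ 2)

/-- The iterates `x₀, x₁, …` of zeroth-order gradient descent along the directions `u₀, u₁, …`:
`x_{t+1} = x_t - η_t g(x_t)`. -/
def iterate {d : ℕ} (f : EuclideanSpace ℝ (Fin d) → ℝ) (L α : ℝ)
    (x₀ : EuclideanSpace ℝ (Fin d)) (u : ℕ → EuclideanSpace ℝ (Fin d)) :
    ℕ → EuclideanSpace ℝ (Fin d)
  | 0 => x₀
  | t + 1 =>
    iterate f L α x₀ u t - stepSize L (u t) • gradEstimate f α (iterate f L α x₀ u t) (u t)

end ZerothOrder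

end

/-!
Write `cₜ` for the cosine of the angle between `∇f(xₜ)` and `uₜ`, and `c = μ / (4 L)`. Smoothness,
strong convexity and the Polyak-Łojasiewicz inequality give the pathwise recursion
`Δₜ₊₁ ≤ (1 - c cₜ²) Δₜ + (5/256) L α² ‖uₜ‖²` for the suboptimality `Δₜ = f(xₜ) - f(x*)`
(`suboptimality_step_le`). Unrolled (`suboptimality_le_certificate`), it bounds `Δ_T` by
`exp (-(c / d) A_T) Δ₀ + (5/256) L α² S_T`, where `A_T = ∑ d cₜ²` and
`Sₜ₊₁ = (1 - c cₜ²) Sₜ + ‖uₜ‖²`, so two tail estimates remain, each failing with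
probability at most `δ / 3`.

* Rotation invariance alone determines `E cₜ² = 1 / d` and `E cₜ⁴ = 3 / (d (d + 2))`, whence
  `E exp (-y d cₜ²) ≤ 5/6` for `y ≥ 1/3`. Hence `E exp (-A_T / 3) ≤ (5/6)^T ≤ exp (-T / 6)`, and
  Markov's inequality gives `A_T ≥ T / 2 - 3 log (3 / δ)`.
* Take `θ = 1 / (10 d)`. The Gaussian measure weighted by `exp (θ ‖u‖²)` is rotation invariant as
  well, with mass at most `9/8`. So `exp (θ Sₜ)` contracts in mean by `9/8 * 5/6 = 15/16` when `Sₜ`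
  is above a level of order `d² / c`, and its mean after the step is bounded when `Sₜ` is below it.
  Therefore `E exp (θ S_T) ≤ 18 exp (d / (3 c))` uniformly in `T`, and Markov's inequality gives
  `S_T ≤ 10 d (d / (3 c) + log 18 + log (3 / δ))`. This is free of `T`; the iterated logarithm in
  the stated bound only has to be bounded below.

The adaptivity of the iterates is harmless because the state at time `t` is independent of `uₜ`
(`indepFun_recursion`), and the one-step estimates hold uniformly over the state.
-/

namespace ZerothOrder

lemma exp_neg_le_quadratic {x : ℝ} (hx : 0 ≤ x) : Real.exp (-x) ≤ 1 - x + x ^ 2 / 2 := by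
  rw [Real.exp_neg, inv_le_iff_one_le_mul₀ (Real.exp_pos x)]
  have h := Real.quadratic_le_exp_of_nonneg hx
  have hp : 0 ≤ 1 - x + x ^ 2 / 2 := by nlinarith [sq_nonneg (x - 1)]
  calc (1 : ℝ) ≤ (1 - x + x ^ 2 / 2) * (1 + x + x ^ 2 / 2) := by nlinarith [sq_nonneg (x ^ 2)]
    _ ≤ _ := mul_le_mul_of_nonneg_left h hp

/-! ### Rotation-invariant measures -/

section RotationInvariant

variable {E : Type*} [NormedAddCommGroup E] [InnerProductSpace ℝ E]

/-- The squared cosine of the angle between a unit vector `e` and `u`; it is `0` at `u = 0`. -/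
noncomputable def cosSq (e u : E) : ℝ := (inner ℝ e u / ‖u‖) ^ 2

lemma cosSq_nonneg (e u : E) : 0 ≤ cosSq e u := sq_nonneg _

lemma abs_inner_div_norm_le (e u : E) : |inner ℝ e u / ‖u‖| ≤ ‖e‖ := by
  rw [abs_div, abs_norm]
  exact div_le_of_le_mul₀ (norm_nonneg _) (norm_nonneg _) (abs_real_inner_le_norm e u)

lemma cosSq_le_one {e : E} (he : ‖e‖ = 1) (u : E) : cosSq e u ≤ 1 := by
  have h := abs_inner_div_norm_le e u
  rw [he] at h
  exact (sq_le_one_iff_abs_le_one _).2 h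

lemma sum_sq_inner_div_norm {ι : Type*} [Fintype ι] (b : OrthonormalBasis ι ℝ E) {u : E}
    (hu : u ≠ 0) : ∑ i, (inner ℝ (b i) u / ‖u‖) ^ 2 = 1 := by
  simp_rw [div_pow, ← Finset.sum_div]
  rw [b.sum_sq_inner_right, div_self]
  simpa using hu

variable [MeasurableSpace E]

/-- Invariance of a measure under all linear isometries. -/
def IsRotationInvariant (ν : Measure E) : Prop :=
  ∀ R : E ≃ₗᵢ[ℝ] E, MeasurePreserving R ν ν

variable {ν : Measure E} [BorelSpace E]

/-- A reflection carries `v` to any vector `w` of the same norm. -/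
lemma IsRotationInvariant.integral_inner_div_norm_pow_congr (hν : IsRotationInvariant ν)
    {v w : E} (hvw : ‖v‖ = ‖w‖) (k : ℕ) :
    ∫ u, (inner ℝ v u / ‖u‖) ^ k ∂ν = ∫ u, (inner ℝ w u / ‖u‖) ^ k ∂ν := by
  have hR := Submodule.reflection_sub hvw
  set R : E ≃ₗᵢ[ℝ] E := Submodule.reflection (Submodule.span ℝ {v - w})ᗮ
  rw [← (hν R).integral_comp R.toHomeomorph.measurableEmbedding
    (fun u => (inner ℝ w u / ‖u‖) ^ k)]
  refine integral_congr_ae (.of_forall fun u => ?_)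
  simp only [← hR, R.inner_map_map, R.norm_map]

lemma measurable_inner_div_norm (e : E) : Measurable fun u : E => inner ℝ e u / ‖u‖ := by
  fun_prop

variable [IsFiniteMeasure ν]

lemma integrable_inner_div_norm_pow (e : E) (k : ℕ) :
    Integrable (fun u => (inner ℝ e u / ‖u‖) ^ k) ν := by
  refine Integrable.of_bound
    ((measurable_inner_div_norm e).pow_const k).aestronglyMeasurable (‖e‖ ^ k)
    (.of_forall fun u => ?_)
  rw [Real.norm_eq_abs, abs_pow]
  exact pow_le_pow_left₀ (abs_nonneg _) (abs_inner_div_norm_le e u) k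

lemma integrable_sq_mul_sq (v w : E) :
    Integrable (fun u => (inner ℝ v u / ‖u‖) ^ 2 * (inner ℝ w u / ‖u‖) ^ 2) ν := by
  refine Integrable.of_bound (((measurable_inner_div_norm v).pow_const 2).mul
    ((measurable_inner_div_norm w).pow_const 2)).aestronglyMeasurable (‖v‖ ^ 2 * ‖w‖ ^ 2)
    (.of_forall fun u => ?_)
  rw [Real.norm_eq_abs, abs_mul, abs_pow, abs_pow]
  gcongr <;> exact abs_inner_div_norm_le _ u

/-- Rotating the plane of two orthonormal vectors by 45 degrees expresses the mixed fourth moment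
through the pure one. -/
lemma IsRotationInvariant.three_mul_integral_sq_mul_sq (hν : IsRotationInvariant ν)
    {e v w : E} (he : ‖e‖ = 1) (hv : ‖v‖ = 1) (hw : ‖w‖ = 1) (hvw : inner ℝ v w = 0) :
    3 * ∫ u, (inner ℝ v u / ‖u‖) ^ 2 * (inner ℝ w u / ‖u‖) ^ 2 ∂ν
      = ∫ u, (inner ℝ e u / ‖u‖) ^ 4 ∂ν := by
  have hs : ‖√2 • e‖ = √2 := by
    rw [norm_smul, he, Real.norm_of_nonneg (Real.sqrt_nonneg 2), mul_one]
  have hadd : ‖v + w‖ = ‖√2 • e‖ := by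
    rw [hs, eq_comm, Real.sqrt_eq_iff_mul_self_eq (by norm_num) (norm_nonneg _),
      norm_add_mul_self_real, hv, hw, hvw]; norm_num
  have hsub : ‖v - w‖ = ‖√2 • e‖ := by
    rw [hs, eq_comm, Real.sqrt_eq_iff_mul_self_eq (by norm_num) (norm_nonneg _),
      norm_sub_mul_self_real, hv, hw, hvw]; norm_num
  have h4 : ∫ u, (inner ℝ (√2 • e) u / ‖u‖) ^ 4 ∂ν = 4 * ∫ u, (inner ℝ e u / ‖u‖) ^ 4 ∂ν := by
    rw [← integral_const_mul]
    refine integral_congr_ae (.of_forall fun u => ?_)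
    have h2 : √2 ^ 4 = (4 : ℝ) := by
      rw [show (4 : ℕ) = 2 * 2 from rfl, pow_mul, Real.sq_sqrt (by norm_num)]; norm_num
    simp only [inner_smul_left, RCLike.conj_to_real, mul_div_assoc, mul_pow, h2]
  have ha := (hν.integral_inner_div_norm_pow_congr hadd 4).trans h4
  have hb := (hν.integral_inner_div_norm_pow_congr hsub 4).trans h4
  have hev := hν.integral_inner_div_norm_pow_congr (hv.trans he.symm) 4
  have hew := hν.integral_inner_div_norm_pow_congr (hw.trans he.symm) 4
  have key : ∫ u, ((inner ℝ (v + w) u / ‖u‖) ^ 4 + (inner ℝ (v - w) u / ‖u‖) ^ 4) ∂ν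
      = ∫ u, (2 * (inner ℝ v u / ‖u‖) ^ 4
        + 12 * ((inner ℝ v u / ‖u‖) ^ 2 * (inner ℝ w u / ‖u‖) ^ 2)
        + 2 * (inner ℝ w u / ‖u‖) ^ 4) ∂ν := by
    refine integral_congr_ae (.of_forall fun u => ?_)
    simp only [inner_add_left, inner_sub_left]
    ring
  have i4 := fun x : E => integrable_inner_div_norm_pow (ν := ν) x 4
  have i22 := integrable_sq_mul_sq (ν := ν) v w
  have iadd : Integrable (fun u => 2 * (inner ℝ v u / ‖u‖) ^ 4
      + 12 * ((inner ℝ v u / ‖u‖) ^ 2 * (inner ℝ w u / ‖u‖) ^ 2)) ν :=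
    ((i4 v).const_mul 2).add (i22.const_mul 12)
  rw [integral_add (i4 _) (i4 _), integral_add iadd ((i4 _).const_mul _),
    integral_add ((i4 _).const_mul _) (i22.const_mul _), integral_const_mul, integral_const_mul,
    integral_const_mul] at key
  linarith

variable [FiniteDimensional ℝ E]

/-- The second moment of the cosine: the `n` coordinates have equal second moments, and their
squares add up to `1`. -/
lemma IsRotationInvariant.finrank_mul_integral_sq (hν : IsRotationInvariant ν) (h0 : ν {0} = 0)
    {e : E} (he : ‖e‖ = 1) :
    (Module.finrank ℝ E : ℝ) * ∫ u, (inner ℝ e u / ‖u‖) ^ 2 ∂ν = ν.real Set.univ := by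
  let b := stdOrthonormalBasis ℝ E
  have hb : ∀ i, ∫ u, (inner ℝ (b i) u / ‖u‖) ^ 2 ∂ν = ∫ u, (inner ℝ e u / ‖u‖) ^ 2 ∂ν :=
    fun i => hν.integral_inner_div_norm_pow_congr (by rw [he, b.norm_eq_one]) 2
  have hsum : ∫ u, ∑ i, (inner ℝ (b i) u / ‖u‖) ^ 2 ∂ν = ∫ _, (1 : ℝ) ∂ν := by
    refine integral_congr_ae ?_
    filter_upwards [compl_mem_ae_iff.2 h0] with u hu
    exact sum_sq_inner_div_norm b hu
  rw [integral_finsetSum _ fun i _ => integrable_inner_div_norm_pow (b i) 2] at hsum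
  simpa [hb] using hsum

/-- The fourth moment of the cosine, from expanding `(∑ᵢ cosᵢ²)² = 1` over an orthonormal basis. -/
lemma IsRotationInvariant.finrank_mul_integral_pow_four (hν : IsRotationInvariant ν)
    (h0 : ν {0} = 0) {e : E} (he : ‖e‖ = 1) :
    (Module.finrank ℝ E : ℝ) * (Module.finrank ℝ E + 2) * ∫ u, (inner ℝ e u / ‖u‖) ^ 4 ∂ν
      = 3 * ν.real Set.univ := by
  let b := stdOrthonormalBasis ℝ E
  set m := ∫ u, (inner ℝ e u / ‖u‖) ^ 4 ∂ν with hm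
  have hij : ∀ i j, ∫ u, (inner ℝ (b i) u / ‖u‖) ^ 2 * (inner ℝ (b j) u / ‖u‖) ^ 2 ∂ν
      = m / 3 + if i = j then 2 * m / 3 else 0 := by
    intro i j
    split_ifs with h
    · subst h
      rw [show m / 3 + 2 * m / 3 = m by ring, hm,
        ← hν.integral_inner_div_norm_pow_congr ((b.norm_eq_one i).trans he.symm) 4]
      simp only [← pow_add]
    · have := hν.three_mul_integral_sq_mul_sq he (b.norm_eq_one i) (b.norm_eq_one j)
        (b.inner_eq_zero h)
      linarith
  have hsum : ∫ u, ∑ i, ∑ j, (inner ℝ (b i) u / ‖u‖) ^ 2 * (inner ℝ (b j) u / ‖u‖) ^ 2 ∂ν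
      = ∫ _, (1 : ℝ) ∂ν := by
    refine integral_congr_ae ?_
    filter_upwards [compl_mem_ae_iff.2 h0] with u hu
    simp only [← Finset.mul_sum, ← Finset.sum_mul, sum_sq_inner_div_norm b hu, one_mul]
  rw [integral_finsetSum _ fun i _ => integrable_finsetSum _ fun j _ =>
    integrable_sq_mul_sq (b i) (b j)] at hsum
  simp_rw [integral_finsetSum _ fun j _ => integrable_sq_mul_sq (b _) (b j), hij] at hsum
  simp [Finset.sum_add_distrib] at hsum
  linear_combination 3 * hsum

/-- The Laplace transform of `n cos²`, for any rotation-invariant measure, from the first two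
moments of `cos²`. -/
lemma IsRotationInvariant.lintegral_exp_neg_cosSq_le (hν : IsRotationInvariant ν)
    (h0 : ν {0} = 0) {e : E} (he : ‖e‖ = 1) {y : ℝ} (hy : 1 / 3 ≤ y) :
    ∫⁻ u, ENNReal.ofReal (Real.exp (-(y * (Module.finrank ℝ E * cosSq e u)))) ∂ν
      ≤ ENNReal.ofReal (5 / 6) * ν Set.univ := by
  set n : ℝ := (Module.finrank ℝ E : ℝ) with hn
  have hn0 : 0 ≤ n := Nat.cast_nonneg _
  have h2 := hν.finrank_mul_integral_sq h0 he
  have h4 := hν.finrank_mul_integral_pow_four h0 he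
  rw [← hn] at h2 h4
  have hm0 : 0 ≤ ∫ u, (inner ℝ e u / ‖u‖) ^ 4 ∂ν := integral_nonneg fun u => by positivity
  have i2 := integrable_inner_div_norm_pow (ν := ν) e 2
  have i4 := integrable_inner_div_norm_pow (ν := ν) e 4
  have iq : Integrable (fun u => 1 - 1 / 3 * n * (inner ℝ e u / ‖u‖) ^ 2) ν :=
    (integrable_const _).sub (i2.const_mul _)
  have hint : ∫ u, (1 - 1 / 3 * n * (inner ℝ e u / ‖u‖) ^ 2
      + n ^ 2 / 18 * (inner ℝ e u / ‖u‖) ^ 4) ∂ν ≤ 5 / 6 * ν.real Set.univ := by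
    rw [integral_add iq (i4.const_mul _), integral_sub (integrable_const _) (i2.const_mul _),
      integral_const_mul, integral_const_mul]
    simp only [integral_const, smul_eq_mul, mul_one]
    nlinarith [mul_nonneg hn0 hm0]
  -- The integrand decreases in `y`; `y = 1 / 3` minimizes `1 - y + (3 / 2) y²`, with value `5 / 6`.
  calc _ ≤ ∫⁻ u, ENNReal.ofReal (1 - 1 / 3 * n * (inner ℝ e u / ‖u‖) ^ 2
      + n ^ 2 / 18 * (inner ℝ e u / ‖u‖) ^ 4) ∂ν := by
        refine lintegral_mono fun u => ENNReal.ofReal_le_ofReal ?_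
        have hc := cosSq_nonneg e u
        calc _ ≤ Real.exp (-(1 / 3 * (n * cosSq e u))) := by gcongr
          _ ≤ _ := exp_neg_le_quadratic (by positivity)
          _ = _ := by unfold cosSq; ring
    _ = ENNReal.ofReal (∫ u, (1 - 1 / 3 * n * (inner ℝ e u / ‖u‖) ^ 2
      + n ^ 2 / 18 * (inner ℝ e u / ‖u‖) ^ 4) ∂ν) := by
        refine (ofReal_integral_eq_lintegral_ofReal
          (iq.add (i4.const_mul (n ^ 2 / 18))) (.of_forall fun u => ?_)).symm
        have : (0 : ℝ) ≤ Real.exp (-(1 / 3 * (n * cosSq e u))) := (Real.exp_pos _).le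
        have h := this.trans (exp_neg_le_quadratic
          (mul_nonneg (by norm_num) (mul_nonneg hn0 (cosSq_nonneg e u))))
        refine h.trans_eq ?_
        simp only [cosSq, Pi.add_apply]; ring
    _ ≤ ENNReal.ofReal (5 / 6 * ν.real Set.univ) := ENNReal.ofReal_le_ofReal hint
    _ = _ := by
        rw [ENNReal.ofReal_mul (by norm_num), measureReal_def,
          ENNReal.ofReal_toReal (measure_ne_top _ _)]

end RotationInvariant

/-! ### The standard Gaussian measure and its exponential tilt -/

section Gaussian

variable {E : Type*} [NormedAddCommGroup E] [InnerProductSpace ℝ E] [FiniteDimensional ℝ E]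
  [MeasurableSpace E] [BorelSpace E]

lemma isRotationInvariant_stdGaussian : IsRotationInvariant (stdGaussian E) :=
  fun R => ⟨R.continuous.measurable, stdGaussian_map R⟩

lemma map_inner_stdGaussian {e : E} (he : ‖e‖ = 1) :
    (stdGaussian E).map (fun u => inner ℝ e u) = gaussianReal 0 1 := by
  have h := IsGaussian.map_eq_gaussianReal (μ := stdGaussian E) (innerSL ℝ e)
  rw [integral_strongDual_stdGaussian, variance_dual_stdGaussian, innerSL_apply_norm, he] at h
  simpa using h

lemma stdGaussian_singleton_zero [Nontrivial E] : stdGaussian E {0} = 0 := by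
  obtain ⟨e, he⟩ := exists_norm_eq E zero_le_one
  have h : gaussianReal 0 1 {0} = 0 := by
    have := nullSingletonClass_gaussianReal (μ := 0) (v := 1) one_ne_zero
    exact measure_singleton 0
  rw [← map_inner_stdGaussian he, Measure.map_apply (by fun_prop) (measurableSet_singleton 0)] at h
  exact measure_mono_null (by simp) h

lemma lintegral_exp_sq_gaussianReal_le :
    ∫⁻ x, ENNReal.ofReal (Real.exp (x ^ 2 / 10)) ∂gaussianReal 0 1 ≤ ENNReal.ofReal (9 / 8) := by
  rw [gaussianReal_of_var_ne_zero _ one_ne_zero,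
    lintegral_withDensity_eq_lintegral_mul _ (measurable_gaussianPDF _ _) (by fun_prop)]
  have hpt : ∀ x : ℝ, (gaussianPDF 0 1 * fun x => ENNReal.ofReal (Real.exp (x ^ 2 / 10))) x
      = ENNReal.ofReal ((√(2 * Real.pi))⁻¹ * Real.exp (-(2 / 5) * x ^ 2)) := by
    intro x
    rw [Pi.mul_apply, gaussianPDF, ← ENNReal.ofReal_mul (gaussianPDFReal_nonneg _ _ _),
      gaussianPDFReal, mul_assoc, ← Real.exp_add]
    simp only [NNReal.coe_one, mul_one, sub_zero]
    congr 3
    ring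
  simp_rw [hpt]
  rw [← ofReal_integral_eq_lintegral_ofReal
    ((integrable_exp_neg_mul_sq (by norm_num)).const_mul _) (.of_forall fun x => by positivity),
    integral_const_mul, integral_gaussian]
  refine ENNReal.ofReal_le_ofReal ?_
  rw [inv_mul_le_iff₀ (by positivity)]
  refine Real.sqrt_le_iff.2 ⟨by positivity, ?_⟩
  rw [mul_pow, Real.sq_sqrt (by positivity)]
  nlinarith [Real.pi_pos]

/-- By convexity of `exp`, the normalized `χ²` exponential moment is at most the one-dimensional
one. -/
lemma lintegral_exp_norm_sq_stdGaussian_le [Nontrivial E] :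
    ∫⁻ u, ENNReal.ofReal (Real.exp (1 / (10 * Module.finrank ℝ E) * ‖u‖ ^ 2)) ∂stdGaussian E
      ≤ ENNReal.ofReal (9 / 8) := by
  let b := stdOrthonormalBasis ℝ E
  set n := Module.finrank ℝ E with hn
  have hn0 : (0 : ℝ) < n := Nat.cast_pos.2 Module.finrank_pos
  have hjensen : ∀ u : E, Real.exp (1 / (10 * n) * ‖u‖ ^ 2)
      ≤ ∑ i, 1 / (n : ℝ) * Real.exp (inner ℝ (b i) u ^ 2 / 10) := by
    intro u
    have h := convexOn_exp.map_sum_le (t := Finset.univ) (w := fun _ : Fin n => 1 / (n : ℝ))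
      (p := fun i => inner ℝ (b i) u ^ 2 / 10) (fun _ _ => by positivity)
      (by simp [hn0.ne']) (fun _ _ => Set.mem_univ _)
    simp only [smul_eq_mul] at h
    refine le_trans (le_of_eq ?_) h
    rw [← Finset.mul_sum, ← Finset.sum_div, b.sum_sq_inner_right]
    congr 1
    field_simp
  have hmarg : ∀ i, ∫⁻ u, ENNReal.ofReal (Real.exp (inner ℝ (b i) u ^ 2 / 10)) ∂stdGaussian E
      ≤ ENNReal.ofReal (9 / 8) := by
    intro i
    refine le_trans (le_of_eq ?_) lintegral_exp_sq_gaussianReal_le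
    rw [← map_inner_stdGaussian (b.norm_eq_one i), lintegral_map (by fun_prop) (by fun_prop)]
  calc _ ≤ ∫⁻ u, ∑ i, ENNReal.ofReal (1 / (n : ℝ))
        * ENNReal.ofReal (Real.exp (inner ℝ (b i) u ^ 2 / 10)) ∂stdGaussian E := by
        refine lintegral_mono fun u => (ENNReal.ofReal_le_ofReal (hjensen u)).trans_eq ?_
        rw [ENNReal.ofReal_sum_of_nonneg fun _ _ => by positivity]
        exact Finset.sum_congr rfl fun _ _ => ENNReal.ofReal_mul (by positivity)
    _ = ∑ i, ENNReal.ofReal (1 / (n : ℝ))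
        * ∫⁻ u, ENNReal.ofReal (Real.exp (inner ℝ (b i) u ^ 2 / 10)) ∂stdGaussian E := by
        rw [lintegral_finsetSum _ fun i _ => by fun_prop]
        exact Finset.sum_congr rfl fun i _ => lintegral_const_mul _ (by fun_prop)
    _ ≤ ∑ _i : Fin n, ENNReal.ofReal (1 / (n : ℝ)) * ENNReal.ofReal (9 / 8) := by
        gcongr with i; exact hmarg i
    _ = _ := by
        rw [Finset.sum_const, Finset.card_univ, Fintype.card_fin, nsmul_eq_mul,
          ← mul_assoc, ← ENNReal.ofReal_natCast, ← ENNReal.ofReal_mul hn0.le,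
          mul_one_div_cancel hn0.ne']
        simp

/-- Under the Gaussian measure tilted by a function of the norm the direction is still uniform, so
the bound on the Laplace transform of `cos²` survives the weight `exp (θ ‖u‖²)`. -/
lemma lintegral_exp_norm_sq_mul_exp_neg_cosSq_le [Nontrivial E] {e : E} (he : ‖e‖ = 1)
    {y : ℝ} (hy : 1 / 3 ≤ y) :
    ∫⁻ u, ENNReal.ofReal (Real.exp (1 / (10 * Module.finrank ℝ E) * ‖u‖ ^ 2))
        * ENNReal.ofReal (Real.exp (-(y * (Module.finrank ℝ E * cosSq e u)))) ∂stdGaussian E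
      ≤ ENNReal.ofReal (15 / 16) := by
  set w : E → ENNReal :=
    fun u => ENNReal.ofReal (Real.exp (1 / (10 * Module.finrank ℝ E) * ‖u‖ ^ 2)) with hw
  have hwm : Measurable w := by fun_prop
  have hmass : (stdGaussian E).withDensity w Set.univ ≤ ENNReal.ofReal (9 / 8) := by
    rw [withDensity_apply _ MeasurableSet.univ, Measure.restrict_univ]
    exact lintegral_exp_norm_sq_stdGaussian_le
  have : IsFiniteMeasure ((stdGaussian E).withDensity w) :=
    ⟨hmass.trans_lt ENNReal.ofReal_lt_top⟩
  have hrot : IsRotationInvariant ((stdGaussian E).withDensity w) := by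
    intro R
    refine ⟨R.continuous.measurable, Measure.ext fun s hs => ?_⟩
    have hR := isRotationInvariant_stdGaussian (E := E) R
    rw [Measure.map_apply R.continuous.measurable hs, withDensity_apply _ hs,
      withDensity_apply _ (R.continuous.measurable hs), ← hR.setLIntegral_comp_preimage hs hwm]
    simp only [hw, R.norm_map]
  have h0 : (stdGaussian E).withDensity w {0} = 0 :=
    withDensity_absolutelyContinuous _ _ stdGaussian_singleton_zero
  have hcm : Measurable fun u : E =>
      ENNReal.ofReal (Real.exp (-(y * (Module.finrank ℝ E * cosSq e u)))) := by
    unfold cosSq; fun_prop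
  have h := hrot.lintegral_exp_neg_cosSq_le h0 he hy
  rw [lintegral_withDensity_eq_lintegral_mul _ hwm hcm] at h
  refine h.trans ((mul_le_mul_right hmass _).trans_eq ?_)
  rw [← ENNReal.ofReal_mul (by norm_num)]
  norm_num

end Gaussian

/-! ### One step of the method -/

section Descent

variable {d : ℕ} {f : EuclideanSpace ℝ (Fin d) → ℝ} {L μ : ℝ}

lemma HasLipschitzGradient.le_quadratic (hf : HasLipschitzGradient f L)
    (x y : EuclideanSpace ℝ (Fin d)) :
    f y ≤ f x + inner ℝ (gradient f x) (y - x) + L / 2 * ‖y - x‖ ^ 2 := by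
  set h := y - x with hh
  let g : ℝ → ℝ := fun t => f (x + t • h) - t * inner ℝ (gradient f x) h - L / 2 * t ^ 2 * ‖h‖ ^ 2
  have hg : ∀ t, HasDerivAt g (inner ℝ (gradient f (x + t • h)) h - inner ℝ (gradient f x) h
      - L * t * ‖h‖ ^ 2) t := by
    intro t
    have h1 : HasDerivAt (fun t : ℝ => x + t • h) h t := by
      simpa using ((hasDerivAt_id t).smul_const h).const_add x
    have h2 := (hf.1 (x + t • h)).hasGradientAt.hasFDerivAt.comp_hasDerivAt t h1
    have h3 := (hasDerivAt_id t).mul_const (inner ℝ (gradient f x) h)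
    have h4 := (((hasDerivAt_id t).pow 2).const_mul (L / 2)).mul_const (‖h‖ ^ 2)
    refine ((h2.sub h3).sub h4).congr_deriv ?_
    simp only [InnerProductSpace.toDual_apply_apply, id]
    push_cast
    ring
  have hanti : AntitoneOn g (Set.Icc 0 1) := by
    refine antitoneOn_of_deriv_nonpos (convex_Icc 0 1)
      (fun t _ => (hg t).continuousAt.continuousWithinAt)
      (fun t _ => (hg t).differentiableAt.differentiableWithinAt) fun t ht => ?_
    rw [interior_Icc] at ht
    rw [(hg t).deriv, ← inner_sub_left]
    have hLip := hf.2 x (x + t • h)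
    rw [add_sub_cancel_left, norm_smul, Real.norm_of_nonneg ht.1.le] at hLip
    nlinarith [real_inner_le_norm (gradient f (x + t • h) - gradient f x) h,
      mul_le_mul_of_nonneg_right hLip (norm_nonneg h)]
  have h01 := hanti (Set.left_mem_Icc.2 zero_le_one) (Set.right_mem_Icc.2 zero_le_one) zero_le_one
  simp only [g, one_smul, zero_smul, add_zero, hh, add_sub_cancel] at h01
  rw [← hh] at h01
  linarith

/-- The Polyak-Łojasiewicz inequality. -/
lemma IsStronglyConvex.two_mul_sub_le_norm_gradient_sq (hf : IsStronglyConvex f μ) (hμ : 0 < μ)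
    (x y : EuclideanSpace ℝ (Fin d)) : 2 * μ * (f x - f y) ≤ ‖gradient f x‖ ^ 2 := by
  have h := hf x y
  have hsq := sq_nonneg ‖μ • (y - x) + gradient f x‖
  rw [norm_add_sq_real, norm_smul, inner_smul_left, Real.norm_of_nonneg hμ.le,
    real_inner_comm] at hsq
  simp only [RCLike.conj_to_real] at hsq
  nlinarith

lemma IsStronglyConvex.le_lipschitz [NeZero d] (hf : IsStronglyConvex f μ)
    (hL : HasLipschitzGradient f L) : μ ≤ L := by
  obtain ⟨e, he⟩ := exists_norm_eq (EuclideanSpace ℝ (Fin d)) zero_le_one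
  have h1 := hf 0 e
  have h2 := hL.le_quadratic 0 e
  simp only [sub_zero, he] at h1 h2
  linarith

lemma abs_symmetric_difference_sub_inner_le (hf : HasLipschitzGradient f L)
    (hc : IsStronglyConvex f μ) (hμ : 0 ≤ μ) {α : ℝ} (hα : 0 < α)
    (x u : EuclideanSpace ℝ (Fin d)) :
    |(f (x + α • u) - f (x - α • u)) / (2 * α) - inner ℝ (gradient f x) u|
      ≤ L * α * ‖u‖ ^ 2 / 4 := by
  have hu1 := hf.le_quadratic x (x + α • u)
  have hu2 := hf.le_quadratic x (x - α • u)
  have hl1 := hc x (x + α • u)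
  have hl2 := hc x (x - α • u)
  have e1 : x + α • u - x = α • u := by abel
  have e2 : x - α • u - x = -(α • u) := by abel
  have hp : 0 ≤ μ / 2 * (α * ‖u‖) ^ 2 := by positivity
  rw [e1, inner_smul_right, norm_smul, Real.norm_of_nonneg hα.le] at hu1 hl1
  rw [e2, inner_neg_right, inner_smul_right, norm_neg, norm_smul,
    Real.norm_of_nonneg hα.le] at hu2 hl2
  rw [div_sub' (by positivity), abs_div, abs_of_pos (by positivity : 0 < 2 * α),
    div_le_iff₀ (by positivity), abs_le]
  constructor <;> nlinarith

/-- A unit vector along the gradient of `f` at `x`, with the fallback value `e₀` at critical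
points. -/
noncomputable def gradientDirection (f : EuclideanSpace ℝ (Fin d) → ℝ)
    (e₀ x : EuclideanSpace ℝ (Fin d)) : EuclideanSpace ℝ (Fin d) :=
  open Classical in if gradient f x = 0 then e₀ else ‖gradient f x‖⁻¹ • gradient f x

lemma norm_gradientDirection {e₀ : EuclideanSpace ℝ (Fin d)} (he₀ : ‖e₀‖ = 1)
    (x : EuclideanSpace ℝ (Fin d)) : ‖gradientDirection f e₀ x‖ = 1 := by
  unfold gradientDirection
  split_ifs with h
  · exact he₀
  · rw [norm_smul, norm_inv, norm_norm, inv_mul_cancel₀ (norm_ne_zero_iff.2 h)]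

lemma norm_smul_gradientDirection (e₀ x : EuclideanSpace ℝ (Fin d)) :
    ‖gradient f x‖ • gradientDirection f e₀ x = gradient f x := by
  unfold gradientDirection
  split_ifs with h
  · simp [h]
  · rw [smul_inv_smul₀ (norm_ne_zero_iff.2 h)]

lemma HasLipschitzGradient.continuous_gradient (hf : HasLipschitzGradient f L) :
    Continuous (gradient f) := by
  refine (LipschitzWith.of_dist_le_mul (K := L.toNNReal) fun x y => ?_).continuous
  rw [dist_eq_norm, dist_eq_norm]
  exact (hf.2 y x).trans (mul_le_mul_of_nonneg_right (Real.le_coe_toNNReal L) (norm_nonneg _))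

lemma HasLipschitzGradient.measurable_gradientDirection (hf : HasLipschitzGradient f L)
    (e₀ : EuclideanSpace ℝ (Fin d)) : Measurable (gradientDirection f e₀) := by
  have hm := hf.continuous_gradient.measurable
  exact Measurable.ite (hm (measurableSet_singleton 0)) measurable_const
    (hm.norm.inv.smul hm)

/-- One step contracts the suboptimality by a factor depending on the angle between the gradient
and the sampled direction, up to a finite-difference error. -/
lemma suboptimality_step_le (hf : HasLipschitzGradient f L) (hc : IsStronglyConvex f μ)
    (hL : 0 < L) (hμ : 0 < μ) {α : ℝ} (hα : 0 < α) (xstar e₀ x u : EuclideanSpace ℝ (Fin d)) :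
    f (x - stepSize L u • gradEstimate f α x u) - f xstar
      ≤ (1 - μ / (4 * L) * cosSq (gradientDirection f e₀ x) u) * (f x - f xstar)
        + 5 / 256 * L * α ^ 2 * ‖u‖ ^ 2 := by
  -- At `u = 0` the step is zero and `cosSq` vanishes, so the claim is an equality.
  rcases eq_or_ne u 0 with rfl | hu
  · simp [gradEstimate, cosSq]
  have hr : 0 < ‖u‖ := norm_pos_iff.2 hu
  have hgap := abs_symmetric_difference_sub_inner_le hf hc hμ.le hα x u
  unfold gradEstimate stepSize
  set D := (f (x + α • u) - f (x - α • u)) / (2 * α)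
  set G := inner ℝ (gradient f x) u with hG
  have hq := hf.le_quadratic x (x - (1 / (4 * L * ‖u‖ ^ 2)) • D • u)
  rw [show x - (1 / (4 * L * ‖u‖ ^ 2)) • D • u - x = (-(1 / (4 * L * ‖u‖ ^ 2) * D)) • u by
    rw [smul_smul, neg_smul]; abel, inner_smul_right, norm_smul, mul_pow, Real.norm_eq_abs,
    sq_abs, ← hG] at hq
  have hcos : G ^ 2 = ‖gradient f x‖ ^ 2 * cosSq (gradientDirection f e₀ x) u * ‖u‖ ^ 2 := by
    rw [hG, ← norm_smul_gradientDirection (f := f) e₀ x, inner_smul_left,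
      norm_smul_gradientDirection, cosSq]
    simp only [RCLike.conj_to_real]
    field_simp
  have hPL : 2 * μ * (f x - f xstar) * cosSq (gradientDirection f e₀ x) u * ‖u‖ ^ 2 ≤ G ^ 2 := by
    rw [hcos]
    have := cosSq_nonneg (gradientDirection f e₀ x) u
    gcongr
    exact hc.two_mul_sub_le_norm_gradient_sq hμ x xstar
  have hsq : (D - G) ^ 2 ≤ (L * α * ‖u‖ ^ 2 / 4) ^ 2 :=
    sq_le_sq' (abs_le.1 hgap).1 (abs_le.1 hgap).2
  -- Young's inequality absorbs the finite-difference error into half of the squared slope.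
  have hyoung : -(D * G) + D ^ 2 / 8 ≤ -(G ^ 2 / 2) + 5 / 4 * (D - G) ^ 2 := by
    nlinarith [sq_nonneg (D + G)]
  have hfin : -(1 / (4 * L * ‖u‖ ^ 2) * D) * G
      + L / 2 * ((-(1 / (4 * L * ‖u‖ ^ 2) * D)) ^ 2 * ‖u‖ ^ 2)
      ≤ -(μ / (4 * L) * cosSq (gradientDirection f e₀ x) u) * (f x - f xstar)
        + 5 / 256 * L * α ^ 2 * ‖u‖ ^ 2 := by
    have hl : -(1 / (4 * L * ‖u‖ ^ 2) * D) * G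
        + L / 2 * ((-(1 / (4 * L * ‖u‖ ^ 2) * D)) ^ 2 * ‖u‖ ^ 2)
        = (-(D * G) + D ^ 2 / 8) / (4 * L * ‖u‖ ^ 2) := by
      field_simp
      ring
    rw [hl, div_le_iff₀ (by positivity)]
    have he : (-(μ / (4 * L) * cosSq (gradientDirection f e₀ x) u) * (f x - f xstar)
        + 5 / 256 * L * α ^ 2 * ‖u‖ ^ 2) * (4 * L * ‖u‖ ^ 2)
        = -(2 * μ * (f x - f xstar) * cosSq (gradientDirection f e₀ x) u * ‖u‖ ^ 2) / 2
          + 5 / 4 * (L * α * ‖u‖ ^ 2 / 4) ^ 2 := by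
      field_simp
      ring
    rw [he]
    linarith
  linarith

end Descent

/-! ### Unrolling the recursion -/

section Certificate

variable {d : ℕ}

/-- One step of the method together with two scalar accumulators: the state is `(x, A, S)`, where
`A` sums the normalized squared cosines and `S` is the discounted sum of the squared norms of the
sampled directions, with discount `1 - c cos²`. -/
noncomputable def certificateStep (f : EuclideanSpace ℝ (Fin d) → ℝ) (L α c : ℝ)
    (e₀ : EuclideanSpace ℝ (Fin d))
    (p : (EuclideanSpace ℝ (Fin d) × ℝ × ℝ) × EuclideanSpace ℝ (Fin d)) :
    EuclideanSpace ℝ (Fin d) × ℝ × ℝ :=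
  (p.1.1 - stepSize L p.2 • gradEstimate f α p.1.1 p.2,
    p.1.2.1 + d * cosSq (gradientDirection f e₀ p.1.1) p.2,
    (1 - c * cosSq (gradientDirection f e₀ p.1.1) p.2) * p.1.2.2 + ‖p.2‖ ^ 2)

/-- The states `(xₜ, Aₜ, Sₜ)` along the directions `u`, from `(x₀, 0, 0)`. -/
noncomputable def certificate (f : EuclideanSpace ℝ (Fin d) → ℝ) (L α c : ℝ)
    (e₀ x₀ : EuclideanSpace ℝ (Fin d)) (u : ℕ → EuclideanSpace ℝ (Fin d)) :
    ℕ → EuclideanSpace ℝ (Fin d) × ℝ × ℝ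
  | 0 => (x₀, 0, 0)
  | t + 1 => certificateStep f L α c e₀ (certificate f L α c e₀ x₀ u t, u t)

variable {f : EuclideanSpace ℝ (Fin d) → ℝ} {L μ α c : ℝ} {e₀ : EuclideanSpace ℝ (Fin d)}

lemma certificate_fst (x₀ : EuclideanSpace ℝ (Fin d)) (u : ℕ → EuclideanSpace ℝ (Fin d)) (t : ℕ) :
    (certificate f L α c e₀ x₀ u t).1 = iterate f L α x₀ u t := by
  induction t with
  | zero => rfl
  | succ t ih => simp only [certificate, certificateStep, iterate, ih]

lemma one_sub_mul_cosSq_nonneg (hc1 : c ≤ 1) {e : EuclideanSpace ℝ (Fin d)} (he : ‖e‖ = 1)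
    (u : EuclideanSpace ℝ (Fin d)) : 0 ≤ 1 - c * cosSq e u := by
  have h1 := cosSq_nonneg e u
  have h2 := cosSq_le_one he u
  nlinarith

lemma certificate_noise_nonneg (hc1 : c ≤ 1) (he₀ : ‖e₀‖ = 1)
    (x₀ : EuclideanSpace ℝ (Fin d)) (u : ℕ → EuclideanSpace ℝ (Fin d)) (t : ℕ) :
    0 ≤ (certificate f L α c e₀ x₀ u t).2.2 := by
  induction t with
  | zero => exact le_rfl
  | succ t ih =>
    have := one_sub_mul_cosSq_nonneg hc1
      (norm_gradientDirection (f := f) he₀ (certificate f L α c e₀ x₀ u t).1) (u t)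
    simp only [certificate, certificateStep]
    positivity

/-- The deterministic core of the bound: the two accumulators control the suboptimality. -/
lemma suboptimality_le_certificate [NeZero d] (hf : HasLipschitzGradient f L)
    (hc : IsStronglyConvex f μ) (hL : 0 < L) (hμ : 0 < μ) (hα : 0 < α) (he₀ : ‖e₀‖ = 1)
    {xstar : EuclideanSpace ℝ (Fin d)} (hmin : ∀ x, f xstar ≤ f x)
    (x₀ : EuclideanSpace ℝ (Fin d)) (u : ℕ → EuclideanSpace ℝ (Fin d)) (t : ℕ) :
    f (iterate f L α x₀ u t) - f xstar
      ≤ Real.exp (-(μ / (4 * L) / d * (certificate f L α (μ / (4 * L)) e₀ x₀ u t).2.1))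
          * (f x₀ - f xstar)
        + 5 / 256 * L * α ^ 2 * (certificate f L α (μ / (4 * L)) e₀ x₀ u t).2.2 := by
  have hd : (d : ℝ) ≠ 0 := NeZero.ne _
  have hμL := hc.le_lipschitz hf
  have hc1 : μ / (4 * L) ≤ 1 := by rw [div_le_one (by positivity)]; linarith
  induction t with
  | zero => simp [iterate, certificate]
  | succ t ih =>
    have hs := suboptimality_step_le hf hc hL hμ hα xstar e₀ (iterate f L α x₀ u t) (u t)
    have hn := norm_gradientDirection (f := f) he₀ (iterate f L α x₀ u t)
    have hcn := one_sub_mul_cosSq_nonneg hc1 hn (u t)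
    simp only [certificate, certificateStep, certificate_fst]
    rw [iterate]
    set q := cosSq (gradientDirection f e₀ (iterate f L α x₀ u t)) (u t)
    set A := (certificate f L α (μ / (4 * L)) e₀ x₀ u t).2.1
    set S := (certificate f L α (μ / (4 * L)) e₀ x₀ u t).2.2
    set a := μ / (4 * L)
    have hexp : (1 - a * q) * Real.exp (-(a / d * A)) ≤ Real.exp (-(a / d * (A + d * q))) := by
      have : -(a / d * (A + d * q)) = -(a * q) + -(a / d * A) := by field_simp; ring
      rw [this, Real.exp_add]
      gcongr
      exact Real.one_sub_le_exp_neg _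
    have h0 : 0 ≤ f x₀ - f xstar := sub_nonneg.2 (hmin x₀)
    have h1 := mul_le_mul_of_nonneg_left ih hcn
    have h2 := mul_le_mul_of_nonneg_right hexp h0
    linarith

lemma HasLipschitzGradient.measurable_certificateStep (hf : HasLipschitzGradient f L) (α c : ℝ)
    (e₀ : EuclideanSpace ℝ (Fin d)) : Measurable (certificateStep f L α c e₀) := by
  have hfm : Measurable f := hf.1.continuous.measurable
  have hx : Measurable fun p : (EuclideanSpace ℝ (Fin d) × ℝ × ℝ) × EuclideanSpace ℝ (Fin d) =>
      p.1.1 := measurable_fst.comp measurable_fst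
  have hu : Measurable fun p : (EuclideanSpace ℝ (Fin d) × ℝ × ℝ) × EuclideanSpace ℝ (Fin d) =>
      p.2 := measurable_snd
  have hq : Measurable fun p : (EuclideanSpace ℝ (Fin d) × ℝ × ℝ) × EuclideanSpace ℝ (Fin d) =>
      cosSq (gradientDirection f e₀ p.1.1) p.2 :=
    ((((hf.measurable_gradientDirection e₀).comp hx).inner hu).div hu.norm).pow_const 2
  have hstep : Measurable (stepSize (d := d) L) :=
    ((measurable_norm.pow_const 2).const_mul (4 * L)).const_div 1
  have hD : Measurable fun p : (EuclideanSpace ℝ (Fin d) × ℝ × ℝ) × EuclideanSpace ℝ (Fin d) =>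
      (f (p.1.1 + α • p.2) - f (p.1.1 - α • p.2)) / (2 * α) :=
    ((hfm.comp (hx.add (hu.const_smul α))).sub (hfm.comp (hx.sub (hu.const_smul α)))).div_const _
  have h1 : Measurable fun p : (EuclideanSpace ℝ (Fin d) × ℝ × ℝ) × EuclideanSpace ℝ (Fin d) =>
      p.1.1 - stepSize L p.2 • gradEstimate f α p.1.1 p.2 :=
    hx.sub ((hstep.comp hu).smul (hD.smul hu))
  have h2 : Measurable fun p : (EuclideanSpace ℝ (Fin d) × ℝ × ℝ) × EuclideanSpace ℝ (Fin d) =>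
      p.1.2.1 + d * cosSq (gradientDirection f e₀ p.1.1) p.2 :=
    (measurable_fst.comp (measurable_snd.comp measurable_fst)).add (hq.const_mul _)
  have h3 : Measurable fun p : (EuclideanSpace ℝ (Fin d) × ℝ × ℝ) × EuclideanSpace ℝ (Fin d) =>
      (1 - c * cosSq (gradientDirection f e₀ p.1.1) p.2) * p.1.2.2 + ‖p.2‖ ^ 2 :=
    ((measurable_const.sub (hq.const_mul _)).mul
      (measurable_snd.comp (measurable_snd.comp measurable_fst))).add (hu.norm.pow_const 2)
  exact h1.prodMk (h2.prodMk h3)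

end Certificate

/-! ### Recursions driven by independent noise -/

section Recursion

variable {Ω S E : Type*} [MeasurableSpace Ω] [MeasurableSpace S] [MeasurableSpace E]
  {P : Measure Ω} {u : ℕ → Ω → E} {Z : ℕ → Ω → S} {Φ : S × E → S} {z₀ : S}

lemma measurable_recursion (hu : ∀ t, Measurable (u t)) (hΦ : Measurable Φ)
    (hZ0 : ∀ ω, Z 0 ω = z₀) (hZ : ∀ t ω, Z (t + 1) ω = Φ (Z t ω, u t ω)) (t : ℕ) :
    Measurable (Z t) := by
  induction t with
  | zero => rw [funext hZ0]; exact measurable_const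
  | succ t ih => rw [funext (hZ t)]; exact hΦ.comp (ih.prodMk (hu t))

/-- The state at time `t` depends on the noise before time `t` only, so it is independent of the
noise at time `t`. -/
lemma indepFun_recursion (hu : ∀ t, Measurable (u t)) (hind : iIndepFun u P) (hΦ : Measurable Φ)
    (hZ0 : ∀ ω, Z 0 ω = z₀) (hZ : ∀ t ω, Z (t + 1) ω = Φ (Z t ω, u t ω)) (t : ℕ) :
    IndepFun (Z t) (u t) P := by
  let m : ℕ → MeasurableSpace Ω := fun i => MeasurableSpace.comap (u i) inferInstance
  have hmeas : ∀ t, Measurable[⨆ i ∈ Set.Iio t, m i] (Z t) := by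
    intro t
    induction t with
    | zero => rw [funext hZ0]; exact measurable_const
    | succ t ih =>
      rw [funext (hZ t)]
      refine hΦ.comp (Measurable.prodMk ?_ ?_)
      · exact ih.mono (biSup_mono fun i (hi : i < t) => Nat.lt_succ_of_lt hi) le_rfl
      · exact (comap_measurable (u t)).mono
          (le_biSup m (show t ∈ Set.Iio (t + 1) from Nat.lt_succ_self t)) le_rfl
  have hdisj : Disjoint (Set.Iio t) {t} := by simp
  have hI := indep_iSup_of_disjoint (fun i => (hu i).comap_le)
    ((iIndepFun_iff_iIndep _ u P).1 hind) hdisj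
  rw [IndepFun_iff_Indep]
  refine indep_of_indep_of_le_left (indep_of_indep_of_le_right hI ?_) (hmeas t).comap_le
  simp

lemma lintegral_recursion_succ [IsProbabilityMeasure P] {γ : Measure E}
    (hu : ∀ t, Measurable (u t)) (hind : iIndepFun u P) (hlaw : ∀ t, P.map (u t) = γ)
    (hΦ : Measurable Φ) (hZ0 : ∀ ω, Z 0 ω = z₀)
    (hZ : ∀ t ω, Z (t + 1) ω = Φ (Z t ω, u t ω)) {V : S → ENNReal} (hV : Measurable V) (t : ℕ) :
    ∫⁻ ω, V (Z (t + 1) ω) ∂P = ∫⁻ ω, ∫⁻ w, V (Φ (Z t ω, w)) ∂γ ∂P := by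
  have hZm := measurable_recursion hu hΦ hZ0 hZ t
  have hprod := (indepFun_iff_map_prod_eq_prod_map_map hZm.aemeasurable (hu t).aemeasurable).1
    (indepFun_recursion hu hind hΦ hZ0 hZ t)
  have hγ : IsProbabilityMeasure γ := hlaw t ▸ Measure.isProbabilityMeasure_map (hu t).aemeasurable
  have hVΦ := hV.comp hΦ
  calc ∫⁻ ω, V (Z (t + 1) ω) ∂P
      = ∫⁻ ω, (V ∘ Φ) (Z t ω, u t ω) ∂P := by simp only [hZ, Function.comp]
    _ = ∫⁻ p, (V ∘ Φ) p ∂P.map (fun ω => (Z t ω, u t ω)) :=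
        (lintegral_map hVΦ (hZm.prodMk (hu t))).symm
    _ = ∫⁻ z, ∫⁻ w, (V ∘ Φ) (z, w) ∂γ ∂P.map (Z t) := by
        rw [hprod, hlaw t, lintegral_prod _ hVΦ.aemeasurable]
    _ = _ := lintegral_map hVΦ.lintegral_prod_right' hZm

/-- Markov's inequality for the exponential of a random variable. -/
lemma measure_lt_le_of_lintegral_exp_le {X : Ω → ℝ} (hX : Measurable X) {B : ℝ}
    (h : ∫⁻ ω, ENNReal.ofReal (Real.exp (X ω)) ∂P ≤ ENNReal.ofReal B) (z : ℝ) :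
    P {ω | z < X ω} ≤ ENNReal.ofReal (Real.exp (-z) * B) := by
  calc P {ω | z < X ω}
      ≤ ∫⁻ ω, ENNReal.ofReal (Real.exp (-z)) * ENNReal.ofReal (Real.exp (X ω)) ∂P := by
        refine meas_le_lintegral₀ (by fun_prop) fun ω (hω : z < X ω) => ?_
        rw [← ENNReal.ofReal_mul (Real.exp_pos _).le, ← Real.exp_add, ← ENNReal.ofReal_one]
        exact ENNReal.ofReal_le_ofReal (Real.one_le_exp (by linarith))
    _ = ENNReal.ofReal (Real.exp (-z)) * ∫⁻ ω, ENNReal.ofReal (Real.exp (X ω)) ∂P :=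
        lintegral_const_mul _ (by fun_prop)
    _ ≤ _ := by
        rw [ENNReal.ofReal_mul (Real.exp_pos _).le]
        gcongr

lemma one_sub_add_le_measureReal [IsProbabilityMeasure P] {G B₁ B₂ : Set Ω} {p q : ℝ}
    (h : ∀ ω, ω ∉ B₁ → ω ∉ B₂ → ω ∈ G) (h₁ : P.real B₁ ≤ p) (h₂ : P.real B₂ ≤ q) :
    1 - (p + q) ≤ P.real G := by
  have hcover : (Set.univ : Set Ω) ⊆ G ∪ (B₁ ∪ B₂) := by
    intro ω _
    by_contra hω
    simp only [Set.mem_union, not_or] at hω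
    exact hω.1 (h ω hω.2.1 hω.2.2)
  have hmono := measureReal_mono (μ := P) hcover
  rw [probReal_univ] at hmono
  linarith [measureReal_union_le (μ := P) G (B₁ ∪ B₂), measureReal_union_le (μ := P) B₁ B₂]

end Recursion

/-! ### Exponential moments of the two accumulators -/

section Moments

variable {d : ℕ}

lemma lintegral_exp_neg_alignment_le [NeZero d] {e : EuclideanSpace ℝ (Fin d)} (he : ‖e‖ = 1)
    (A : ℝ) :
    ∫⁻ w, ENNReal.ofReal (Real.exp (-(1 / 3 * (A + d * cosSq e w))))
        ∂stdGaussian (EuclideanSpace ℝ (Fin d))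
      ≤ ENNReal.ofReal (5 / 6) * ENNReal.ofReal (Real.exp (-(1 / 3 * A))) := by
  have h := isRotationInvariant_stdGaussian.lintegral_exp_neg_cosSq_le
    stdGaussian_singleton_zero he le_rfl
  rw [measure_univ, mul_one, finrank_euclideanSpace_fin] at h
  have hm : Measurable fun w => ENNReal.ofReal (Real.exp (-(1 / 3 * (d * cosSq e w)))) := by
    unfold cosSq; fun_prop
  simp_rw [mul_add, neg_add, Real.exp_add, ENNReal.ofReal_mul (Real.exp_pos _).le]
  rw [lintegral_const_mul _ hm, mul_comm]
  gcongr

/-- The drift of the exponential moment of the noise accumulator: it contracts when `S` exceeds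
`10 d² / (3 c)`, and stays bounded below that level. -/
lemma lintegral_exp_noise_le [NeZero d] {e : EuclideanSpace ℝ (Fin d)} (he : ‖e‖ = 1) {c S : ℝ}
    (hc : 0 < c) (hS : 0 ≤ S) :
    ∫⁻ w, ENNReal.ofReal (Real.exp (1 / (10 * d) * ((1 - c * cosSq e w) * S + ‖w‖ ^ 2)))
        ∂stdGaussian (EuclideanSpace ℝ (Fin d))
      ≤ ENNReal.ofReal (15 / 16) * ENNReal.ofReal (Real.exp (1 / (10 * d) * S))
        + ENNReal.ofReal (9 / 8 * Real.exp (d / (3 * c))) := by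
  have hd : (0 : ℝ) < d := Nat.cast_pos.2 (NeZero.pos d)
  -- The exponent is `θ S + θ ‖w‖² - y (d cos²)` with `θ = 1 / (10 d)` and `y = θ c S / d`.
  by_cases hy : 1 / 3 ≤ 1 / (10 * d) * c * S / d
  · have h := lintegral_exp_norm_sq_mul_exp_neg_cosSq_le he hy
    rw [finrank_euclideanSpace_fin] at h
    refine le_trans ?_ le_self_add
    have hm : Measurable fun w => ENNReal.ofReal (Real.exp (1 / (10 * d) * ‖w‖ ^ 2))
        * ENNReal.ofReal (Real.exp (-(1 / (10 * d) * c * S / d * (d * cosSq e w)))) := by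
      unfold cosSq; fun_prop
    calc _ = ∫⁻ w, ENNReal.ofReal (Real.exp (1 / (10 * d) * S))
          * (ENNReal.ofReal (Real.exp (1 / (10 * d) * ‖w‖ ^ 2))
          * ENNReal.ofReal (Real.exp (-(1 / (10 * d) * c * S / d * (d * cosSq e w)))))
          ∂stdGaussian (EuclideanSpace ℝ (Fin d)) := by
          refine lintegral_congr fun w => ?_
          rw [← ENNReal.ofReal_mul (Real.exp_pos _).le, ← ENNReal.ofReal_mul (Real.exp_pos _).le,
            ← Real.exp_add, ← Real.exp_add]
          congr 2
          field_simp
          ring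
      _ ≤ _ := by
          rw [lintegral_const_mul _ hm, mul_comm]
          gcongr
  · have h := lintegral_exp_norm_sq_stdGaussian_le (E := EuclideanSpace ℝ (Fin d))
    rw [finrank_euclideanSpace_fin] at h
    refine le_trans ?_ le_add_self
    have hlow : 1 / (10 * d) * S ≤ d / (3 * c) := by
      rw [not_le, div_lt_iff₀ hd] at hy
      rw [le_div_iff₀ (by positivity)]
      linarith
    calc _ ≤ ∫⁻ w, ENNReal.ofReal (Real.exp (d / (3 * c)))
          * ENNReal.ofReal (Real.exp (1 / (10 * d) * ‖w‖ ^ 2))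
          ∂stdGaussian (EuclideanSpace ℝ (Fin d)) := by
          refine lintegral_mono fun w => ?_
          rw [← ENNReal.ofReal_mul (Real.exp_pos _).le, ← Real.exp_add]
          refine ENNReal.ofReal_le_ofReal (Real.exp_le_exp.2 ?_)
          have h0 : 0 ≤ 1 / (10 * d) * (c * cosSq e w * S) := by
            have := cosSq_nonneg e w
            positivity
          linarith
      _ ≤ _ := by
          rw [lintegral_const_mul _ (by fun_prop), mul_comm, ENNReal.ofReal_mul (by norm_num)]
          gcongr

variable {Ω : Type*} [MeasurableSpace Ω] {P : Measure Ω} [IsProbabilityMeasure P]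
  {u : ℕ → Ω → EuclideanSpace ℝ (Fin d)} {f : EuclideanSpace ℝ (Fin d) → ℝ} {L : ℝ}
  {e₀ : EuclideanSpace ℝ (Fin d)}

lemma measurable_certificate (hf : HasLipschitzGradient f L) (hu : ∀ t, Measurable (u t))
    (α c : ℝ) (e₀ x₀ : EuclideanSpace ℝ (Fin d)) (t : ℕ) :
    Measurable fun ω => certificate f L α c e₀ x₀ (fun s => u s ω) t :=
  measurable_recursion (Z := fun t ω => certificate f L α c e₀ x₀ (fun s => u s ω) t) hu
    (hf.measurable_certificateStep α c e₀) (fun _ => rfl) (fun _ _ => rfl) t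

/-- The angles are uniform given the past, so the one-step factor `5/6` compounds. -/
lemma lintegral_exp_neg_certificate_le [NeZero d] (hf : HasLipschitzGradient f L)
    (hu : ∀ t, Measurable (u t)) (hind : iIndepFun u P)
    (hlaw : ∀ t, P.map (u t) = stdGaussian (EuclideanSpace ℝ (Fin d)))
    (he₀ : ‖e₀‖ = 1) (α c : ℝ) (x₀ : EuclideanSpace ℝ (Fin d)) (t : ℕ) :
    ∫⁻ ω, ENNReal.ofReal (Real.exp
        (-(1 / 3 * (certificate f L α c e₀ x₀ (fun s => u s ω) t).2.1))) ∂P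
      ≤ ENNReal.ofReal ((5 / 6) ^ t) := by
  induction t with
  | zero => simp [certificate]
  | succ t ih =>
    rw [lintegral_recursion_succ (V := fun z => ENNReal.ofReal (Real.exp (-(1 / 3 * z.2.1))))
      (Z := fun t ω => certificate f L α c e₀ x₀ (fun s => u s ω) t) hu hind hlaw
      (hf.measurable_certificateStep α c e₀) (fun _ => rfl) (fun _ _ => rfl) (by fun_prop)]
    have hm := measurable_certificate hf hu α c e₀ x₀ t
    set Z := fun ω => certificate f L α c e₀ x₀ (fun s => u s ω) t
    have hdrift : ∀ ω, ∫⁻ w, ENNReal.ofReal (Real.exp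
        (-(1 / 3 * (certificateStep f L α c e₀ (Z ω, w)).2.1)))
          ∂stdGaussian (EuclideanSpace ℝ (Fin d))
        ≤ ENNReal.ofReal (5 / 6) * ENNReal.ofReal (Real.exp (-(1 / 3 * (Z ω).2.1))) := fun ω =>
      lintegral_exp_neg_alignment_le (norm_gradientDirection (f := f) he₀ (Z ω).1) (Z ω).2.1
    refine (lintegral_mono hdrift).trans ?_
    rw [lintegral_const_mul _ (by fun_prop), pow_succ', ENNReal.ofReal_mul (by norm_num)]
    gcongr

/-- The exponential moment of the noise accumulator is bounded uniformly in time. -/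
lemma lintegral_exp_certificate_noise_le [NeZero d] (hf : HasLipschitzGradient f L)
    (hu : ∀ t, Measurable (u t)) (hind : iIndepFun u P)
    (hlaw : ∀ t, P.map (u t) = stdGaussian (EuclideanSpace ℝ (Fin d)))
    (he₀ : ‖e₀‖ = 1) (α : ℝ) {c : ℝ} (hc : 0 < c) (hc1 : c ≤ 1)
    (x₀ : EuclideanSpace ℝ (Fin d)) (t : ℕ) :
    ∫⁻ ω, ENNReal.ofReal (Real.exp
        (1 / (10 * d) * (certificate f L α c e₀ x₀ (fun s => u s ω) t).2.2)) ∂P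
      ≤ ENNReal.ofReal (18 * Real.exp (d / (3 * c))) := by
  have hexp : 1 ≤ Real.exp ((d : ℝ) / (3 * c)) := Real.one_le_exp (by positivity)
  induction t with
  | zero =>
    simp only [certificate, mul_zero, Real.exp_zero, lintegral_const, measure_univ, mul_one]
    exact ENNReal.ofReal_le_ofReal (by linarith)
  | succ t ih =>
    rw [lintegral_recursion_succ
      (V := fun z => ENNReal.ofReal (Real.exp (1 / (10 * d) * z.2.2)))
      (Z := fun t ω => certificate f L α c e₀ x₀ (fun s => u s ω) t) hu hind hlaw
      (hf.measurable_certificateStep α c e₀) (fun _ => rfl) (fun _ _ => rfl) (by fun_prop)]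
    have hm := measurable_certificate hf hu α c e₀ x₀ t
    have hS : ∀ ω, 0 ≤ (certificate f L α c e₀ x₀ (fun s => u s ω) t).2.2 := fun ω =>
      certificate_noise_nonneg hc1 he₀ x₀ (fun s => u s ω) t
    set Z := fun ω => certificate f L α c e₀ x₀ (fun s => u s ω) t
    have hdrift : ∀ ω, ∫⁻ w, ENNReal.ofReal (Real.exp
        (1 / (10 * d) * (certificateStep f L α c e₀ (Z ω, w)).2.2))
          ∂stdGaussian (EuclideanSpace ℝ (Fin d))
        ≤ ENNReal.ofReal (15 / 16) * ENNReal.ofReal (Real.exp (1 / (10 * d) * (Z ω).2.2))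
          + ENNReal.ofReal (9 / 8 * Real.exp (d / (3 * c))) := fun ω =>
      lintegral_exp_noise_le (norm_gradientDirection (f := f) he₀ (Z ω).1) hc (hS ω)
    refine (lintegral_mono hdrift).trans ?_
    rw [lintegral_add_right _ measurable_const, lintegral_const_mul _ (by fun_prop),
      lintegral_const, measure_univ, mul_one]
    -- The constant 18 solves `15 / 16 * B + 9 / 8 = B`.
    calc _ ≤ ENNReal.ofReal (15 / 16) * ENNReal.ofReal (18 * Real.exp (d / (3 * c)))
          + ENNReal.ofReal (9 / 8 * Real.exp (d / (3 * c))) := by gcongr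
      _ = _ := by
          rw [← ENNReal.ofReal_mul (by norm_num), ← ENNReal.ofReal_add (by positivity)
            (by positivity)]
          congr 1
          ring

end Moments

/-! ### The high-probability bound -/

lemma one_le_log_three_div {δ : ℝ} (h0 : 0 < δ) (h1 : δ < 1) : 1 ≤ Real.log (3 / δ) := by
  rw [Real.le_log_iff_exp_le (by positivity), le_div_iff₀ h0]
  nlinarith [Real.exp_one_lt_d9, Real.exp_pos 1]

lemma neg_half_le_log_log_two_mul {T : ℕ} (hT : 1 ≤ T) :
    -(1 / 2) ≤ Real.log (Real.log (2 * T)) := by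
  have hT' : (1 : ℝ) ≤ T := by exact_mod_cast hT
  have hl : Real.log 2 ≤ Real.log (2 * T) := Real.log_le_log (by norm_num) (by linarith)
  have h2 := Real.log_two_gt_d9
  rw [Real.le_log_iff_exp_le (by linarith), Real.exp_neg, inv_le_comm₀ (Real.exp_pos _)
    (by linarith)]
  have h3 : (Real.log (2 * T))⁻¹ ≤ 3 / 2 := by
    rw [inv_le_comm₀ (by linarith) (by norm_num)]; linarith
  linarith [Real.add_one_le_exp (1 / 2 : ℝ)]

end ZerothOrder

theorem mainTheorem1 (d : ℕ) (hd : 1 ≤ d) (L μ : ℝ) (hL : 0 < L) (hμ : 0 < μ)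
    (f : EuclideanSpace ℝ (Fin d) → ℝ)
    (hsmooth : ZerothOrder.HasLipschitzGradient f L)
    (hconv : ZerothOrder.IsStronglyConvex f μ)
    (xstar : EuclideanSpace ℝ (Fin d)) (hmin : ∀ x, f xstar ≤ f x)
    (x₀ : EuclideanSpace ℝ (Fin d)) (α : ℝ) (hα : 0 < α)
    (T : ℕ) (hT : 1 ≤ T) (δ : ℝ) (hδ₀ : 0 < δ) (hδ₁ : δ < 1)
    {Ω : Type*} [MeasurableSpace Ω] (P : Measure Ω) [IsProbabilityMeasure P]
    (u : ℕ → Ω → EuclideanSpace ℝ (Fin d)) (hu_meas : ∀ t, Measurable (u t))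
    (hu_indep : iIndepFun u P)
    (hu_law : ∀ t, P.map (u t) = stdGaussian (EuclideanSpace ℝ (Fin d))) :
    1 - δ ≤ P.real {ω |
      f (ZerothOrder.iterate f L α x₀ (fun t => u t ω) T) - f xstar ≤
        Real.exp (-(μ / (8 * L)) * (T / (2 * d) - 6 * Real.log (3 / δ) / d)) * (f x₀ - f xstar)
        + d * L * α ^ 2 / 16 *
          (1004 + 1000 * (Real.log (3 / δ) + Real.log (Real.log (2 * T)))
            + 32 * d * L / μ + 3 * Real.log (3 / δ))} := by
  have : NeZero d := ⟨by omega⟩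
  have hd0 : (0 : ℝ) < d := Nat.cast_pos.2 (NeZero.pos d)
  obtain ⟨e₀, he₀⟩ := exists_norm_eq (EuclideanSpace ℝ (Fin d)) zero_le_one
  have hμL := hconv.le_lipschitz hsmooth
  set c := μ / (4 * L) with hc
  have hc0 : 0 < c := by positivity
  have hc1 : c ≤ 1 := by rw [hc, div_le_one (by positivity)]; linarith
  set ℓ := Real.log (3 / δ) with hℓ
  have hℓ1 : 1 ≤ ℓ := ZerothOrder.one_le_log_three_div hδ₀ hδ₁
  have hexpℓ : Real.exp (-ℓ) = δ / 3 := by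
    rw [hℓ, Real.exp_neg, Real.exp_log (by positivity), inv_div]
  let Z := fun ω => ZerothOrder.certificate f L α c e₀ x₀ (fun s => u s ω) T
  have hZm : Measurable Z := ZerothOrder.measurable_certificate hsmooth hu_meas α c e₀ x₀ T
  have hA : P.real {ω | -(T / 6 - ℓ) < -(1 / 3 * (Z ω).2.1)} ≤ δ / 3 := by
    refine ENNReal.toReal_le_of_le_ofReal (by positivity)
      ((ZerothOrder.measure_lt_le_of_lintegral_exp_le
        (hZm.snd.fst.const_mul _).neg
        (ZerothOrder.lintegral_exp_neg_certificate_le hsmooth hu_meas hu_indep hu_law he₀ α c x₀ T)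
        _).trans (ENNReal.ofReal_le_ofReal ?_))
    have h56 : (5 / 6 : ℝ) ^ T ≤ Real.exp (-(T / 6)) := by
      rw [show -((T : ℝ) / 6) = T * (-(1 / 6)) by ring, Real.exp_nat_mul]
      gcongr
      linarith [Real.add_one_le_exp (-(1 / 6) : ℝ)]
    calc _ ≤ Real.exp (-(-(T / 6 - ℓ))) * Real.exp (-(T / 6)) := by gcongr
      _ = δ / 3 := by rw [← Real.exp_add, ← hexpℓ]; congr 1; ring
  have hS : P.real {ω | d / (3 * c) + Real.log 18 + ℓ < 1 / (10 * d) * (Z ω).2.2} ≤ δ / 3 := by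
    refine ENNReal.toReal_le_of_le_ofReal (by positivity)
      ((ZerothOrder.measure_lt_le_of_lintegral_exp_le
        (hZm.snd.snd.const_mul _)
        (ZerothOrder.lintegral_exp_certificate_noise_le hsmooth hu_meas hu_indep hu_law he₀ α hc0
          hc1 x₀ T) _).trans (ENNReal.ofReal_le_ofReal (le_of_eq ?_)))
    rw [neg_add, neg_add, Real.exp_add, Real.exp_add, hexpℓ, Real.exp_neg, Real.exp_neg,
      Real.exp_log (by norm_num)]
    field_simp
  refine le_trans (by linarith) (ZerothOrder.one_sub_add_le_measureReal (fun ω h1 h2 => ?_) hA hS)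
  rw [Set.mem_ofPred_eq, not_lt] at h1 h2
  rw [Set.mem_ofPred_eq]
  refine (ZerothOrder.suboptimality_le_certificate hsmooth hconv hL hμ hα he₀ hmin x₀
    (fun s => u s ω) T).trans (add_le_add ?_ ?_)
  -- The tail bound even gives `T / 2 - 3 ℓ` in place of the `T / 4 - 3 ℓ` needed here.
  · have h0 : 0 ≤ f x₀ - f xstar := sub_nonneg.2 (hmin x₀)
    gcongr
    calc -(c / d * (Z ω).2.1) ≤ -(c / d * (T / 4 - 3 * ℓ)) := by
          gcongr
          have : (0 : ℝ) ≤ T := Nat.cast_nonneg T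
          linarith
      _ = _ := by rw [hc]; field_simp; ring
  · have hlog18 : Real.log 18 ≤ 17 := by
      linarith [Real.log_le_sub_one_of_pos (show (0 : ℝ) < 18 by norm_num)]
    have hll := ZerothOrder.neg_half_le_log_log_two_mul hT
    have hdc : (d : ℝ) / (3 * c) = 4 / 3 * (d * L / μ) := by rw [hc]; field_simp
    have hdL : 0 ≤ d * L / μ := by positivity
    have hSle : (Z ω).2.2 ≤ 10 * d * (d / (3 * c) + Real.log 18 + ℓ) := by
      rw [one_div, inv_mul_le_iff₀ (by positivity)] at h2
      exact h2
    calc 5 / 256 * L * α ^ 2 * (Z ω).2.2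
        ≤ 5 / 256 * L * α ^ 2 * (10 * d * (d / (3 * c) + Real.log 18 + ℓ)) := by gcongr
      _ = d * L * α ^ 2 / 16 * (25 / 8 * (d / (3 * c) + Real.log 18 + ℓ)) := by ring
      _ ≤ _ := by
        gcongr
        rw [hdc, show 32 * d * L / μ = 32 * (d * L / μ) by ring]
        linarith
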